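/- Let $\mathbb F$ be a perfect field, $\mathbb F^*=\mathbb F\setminus\{0\}$, $\mathbb N=\{1,2,\dots\}$, and let $\sigma_{\mathbb F}$ be the set of monic irreducible polynomials over $\mathbb F$. A multiplicity function is a map $\aleph$ from $\sigma_{\mathbb F}\times\mathbb N$ to the cardinals. The group $\mathbb F^*$ acts on $\sigma_{\mathbb F}$ by $(\lambda\star p)(X)=\lambda^{\deg p}p(X/\lambda)$ and on multiplicity functions by $(\lambda\star\aleph)(\lambda\star p,n)=\aleph(p,n)$. For $p\in\sigma_{\mathbb F}$ let $\mathbb F_p=\mathbb F[X]/(p)=\mathbb F(x_p)$ with $x_p$ the class of $X$, and let $$\mathrm J(p,n)=\mathrm{id}_n\otimes x_p+\mathrm N_n\otimes\mathrm{id}$$ be the Jordan block, an $\mathbb F$-linear operator on $\mathbb F_p^n$, where $\mathrm N_n$ is the nilpotent $n\times n$ block with ones above the diagonal. Put $$\mathrm J(\aleph)=\bigoplus_{p\in\sigma_{\mathbb F}}\bigoplus_{n\ge1}\bigoplus_{\alpha\in\aleph(p,n)}\mathrm J(p,n),$$ acting on the corresponding direct sum of the spaces $\mathbb F_p^n$.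 A linear operator on an $\mathbb F$-vector space is called Jordanable if it is similar to some $\mathrm J(\aleph)$. Call $\aleph$ non-trivial if $\aleph(p,n)\neq0$ for some $(p,n)\neq(X,1)$ (equivalently, $\mathrm J(\aleph)\neq0$); a projective multiplicity function is an orbit $\mathbb F^*\star\aleph$ of a non-trivial multiplicity function. An almost Abelian Lie algebra over $\mathbb F$ is a non-Abelian Lie algebra (of any dimension) that has an Abelian subalgebra of codimension one. It is called Jordanable if it can be written as $\mathbf L=\mathbb Fe_0\rtimes\mathbf V$, with $\mathbf V$ an Abelian ideal of codimension one, such that the operator $\mathrm{ad}_{e_0}$ on $\mathbf V$ is Jordanable. For non-trivial $\aleph$ let $\mathbf{aA}(\aleph)=\mathbb Fe_0\rtimes\mathbf V$, where $\mathbf V$ is the Abelian Lie algebra on the space of $\mathrm J(\aleph)$ and $\mathrm{ad}_{e_0}=\mathrm J(\aleph)$; it is a Jordanable almost Abelian Lie algebra. Then for every Jordanable almost Abelian Lie algebra $\mathbf L$ and every decomposition $\mathbf L=\mathbb Fe_0\rtimes\mathbf V$ as above, there is exactly one multiplicity function $\aleph_{\mathrm{ad}_{e_0}}$ such that $\mathrm{ad}_{e_0}|_{\mathbf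 V}$ is similar to $\mathrm J(\aleph_{\mathrm{ad}_{e_0}})$. It is non-trivial, and its orbit $\mathbb F^*\star\aleph_{\mathrm{ad}_{e_0}}$ depends only on the isomorphism class $[\mathbf L]$. The map $$[\mathbf L]\longmapsto\mathbb F^*\star\aleph_{\mathrm{ad}_{e_0}}$$ is a bijection from the isomorphism classes of Jordanable almost Abelian Lie algebras over $\mathbb F$ to the projective multiplicity functions, and its inverse is $\mathbb F^*\star\aleph\mapsto[\mathbf{aA}(\aleph)]$. -/

import Mathlib

open Polynomial

universe u v w x

noncomputable section

namespace AlmostAbelian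

section Multiplicity

/-- The spectrum `σ_F` of the field `F`: the set of monic irreducible polynomials over `F`. -/
def Spec (F : Type u) [Field F] : Type u := {p : F[X] // p.Monic ∧ Irreducible p}

variable {F : Type u} [Field F]

theorem irreducible_scaleRoots {p : F[X]} (hp : Irreducible p) (c : Fˣ) :
    Irreducible (p.scaleRoots (c : F)) := by
  have key : ∀ (q : F[X]) (d : Fˣ), (q.scaleRoots (d : F)).scaleRoots ((d⁻¹ : Fˣ) : F) = q := by
    intro q d
    rw [← Polynomial.scaleRoots_mul]
    simp
  have unit : ∀ (q : F[X]) (d : Fˣ), IsUnit q → IsUnit (q.scaleRoots (d : F)) := by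
    intro q d hq
    rw [Polynomial.isUnit_iff_degree_eq_zero] at hq ⊢
    rw [Polynomial.degree_scaleRoots, hq]
  refine ⟨fun h => hp.not_isUnit ?_, fun a b hab => ?_⟩
  · have := unit _ c⁻¹ h
    rwa [key] at this
  · have h2 : p = a.scaleRoots ((c⁻¹ : Fˣ) : F) * b.scaleRoots ((c⁻¹ : Fˣ) : F) := by
      rw [← Polynomial.mul_scaleRoots_of_noZeroDivisors, ← hab, key]
    rcases hp.isUnit_or_isUnit h2 with h | h
    · left
      have := unit _ c h
      have k := key a c⁻¹
      rw [inv_inv] at k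
      rwa [k] at this
    · right
      have := unit _ c h
      have k := key b c⁻¹
      rw [inv_inv] at k
      rwa [k] at this

/-- The action of `F*` on the spectrum, `(c ⋆ p)(X) = c ^ deg p * p (X / c)`; the polynomial
`∑ a_k X ^ k` of degree `d` is sent to `∑ c ^ (d - k) a_k X ^ k`. -/
instance : MulAction Fˣ (Spec F) where
  smul c p := ⟨p.1.scaleRoots (c : F),
    (Polynomial.monic_scaleRoots_iff _).2 p.2.1, irreducible_scaleRoots p.2.2 c⟩
  one_smul p := Subtype.ext (by
    change p.1.scaleRoots ((1 : Fˣ) : F) = p.1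
    simp)
  mul_smul c d p := Subtype.ext (by
    change p.1.scaleRoots ((c * d : Fˣ) : F) = (p.1.scaleRoots (d : F)).scaleRoots (c : F)
    rw [← Polynomial.scaleRoots_mul, Units.val_mul, mul_comm])

/-- The monic irreducible polynomial `X`. -/
def Spec.X : Spec F := ⟨Polynomial.X, Polynomial.monic_X, Polynomial.irreducible_X⟩

/-- Multiplicity functions: maps from `σ_F × ℕ` to the cardinals, with `ℕ = {1, 2, …}`. -/
def MultFn (F : Type u) [Field F] : Type (max u (w + 1)) := Spec F × ℕ+ → Cardinal.{w}

/-- The action of `F*` on multiplicity functions by pushforward,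
`(c ⋆ ℵ) (c ⋆ p, n) = ℵ (p, n)`. -/
instance : MulAction Fˣ (MultFn.{u, w} F) where
  smul c ℵ := fun pn => ℵ (c⁻¹ • pn.1, pn.2)
  one_smul ℵ := by
    funext pn
    change ℵ ((1 : Fˣ)⁻¹ • pn.1, pn.2) = ℵ pn
    simp
  mul_smul c d ℵ := by
    funext pn
    change ℵ ((c * d)⁻¹ • pn.1, pn.2) = ℵ (d⁻¹ • c⁻¹ • pn.1, pn.2)
    rw [mul_inv_rev, mul_smul]

theorem MultFn.smul_apply_smul (ℵ : MultFn.{u, w} F) (c : Fˣ) (p : Spec F) (n : ℕ+) :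
    (c • ℵ) (c • p, n) = ℵ (p, n) := by
  change ℵ (c⁻¹ • c • p, n) = ℵ (p, n)
  rw [inv_smul_smul]

end Multiplicity

section Jordan

variable {F : Type u} [Field F]

/-- The space `F_p ^ n` of a Jordan block, where `F_p = F(x_p) = F[X] / (p)`. -/
abbrev BlockSpace (p : Spec F) (n : ℕ+) : Type u := Fin n → AdjoinRoot p.1

/-- The nilpotent Jordan block `N_n` on `F_p ^ n`, with `N_n e^m = e^{m-1}` and `N_n e^1 = 0`:
the `m`-th coordinate of `N_n v` is the `(m+1)`-st coordinate of `v`, the last one is zero. -/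
def nilBlock (p : Spec F) (n : ℕ+) : Module.End F (BlockSpace p n) where
  toFun v := fun m => if h : (m : ℕ) + 1 < n then v ⟨m + 1, h⟩ else 0
  map_add' v w := by
    funext m
    by_cases h : (m : ℕ) + 1 < n <;> simp [h]
  map_smul' c v := by
    funext m
    by_cases h : (m : ℕ) + 1 < n <;> simp [h]

/-- The Jordan block `J(p, n) = 1_n ⊗ x_p + N_n ⊗ 1` as an `F`-linear operator on `F_p ^ n`;
here `x_p` is the multiplication by the root of `p` in `F_p`. -/
def jordanBlock (p : Spec F) (n : ℕ+) : Module.End F (BlockSpace p n) :=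
  LinearMap.pi (fun m => (LinearMap.mulLeft F (AdjoinRoot.root p.1)).comp (LinearMap.proj m))
    + nilBlock p n

theorem jordanBlock_apply (p : Spec F) (n : ℕ+) (v : BlockSpace p n) (m : Fin n) :
    jordanBlock p n v m = AdjoinRoot.root p.1 * v m
      + if h : (m : ℕ) + 1 < n then v ⟨m + 1, h⟩ else 0 := rfl

/-- The set of blocks of the canonical form: `ℵ(p, n)` of them for each `(p, n)`. -/
def BlockIndex (ℵ : MultFn.{u, w} F) : Type (max u w) := Σ pn : Spec F × ℕ+, (ℵ pn).out

/-- `V = ⨁_p ⨁_n ⨁_{α ∈ ℵ(p, n)} F_p ^ n`, a vector space over `F` of dimension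
`∑_p ∑_n n * ℵ(p, n) * deg p`. -/
abbrev JordanSpace (ℵ : MultFn.{u, w} F) : Type (max u w) :=
  DirectSum (BlockIndex ℵ) (fun i => BlockSpace i.1.1 i.1.2)

/-- The Jordan canonical form `J(ℵ) = ⨁_p ⨁_n ⨁_{α ∈ ℵ(p, n)} J(p, n)`. -/
def jordanForm (ℵ : MultFn.{u, w} F) : Module.End F (JordanSpace ℵ) :=
  DirectSum.lmap (fun i : BlockIndex ℵ => jordanBlock i.1.1 i.1.2)

/-- The operator `T` is similar to `J(ℵ)`. -/
def HasJordanForm {V : Type x} [AddCommGroup V] [Module F V] (T : Module.End F V)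
    (ℵ : MultFn.{u, w} F) : Prop :=
  ∃ S : V ≃ₗ[F] JordanSpace ℵ, ∀ y : V, S (T y) = jordanForm ℵ (S y)

/-- The operator `T` is Jordanable: it is similar to some Jordan canonical form. -/
def IsJordanableOp {V : Type w} [AddCommGroup V] [Module F V] (T : Module.End F V) : Prop :=
  ∃ ℵ : MultFn.{u, w} F, HasJordanForm T ℵ

/-- Some block of `ℵ` is different from the zero block `J(X, 1) = 0`. For `ℵ` that do not satisfy
this the operator `J(ℵ)` is zero. -/
def MultFn.Nontriv (ℵ : MultFn.{u, w} F) : Prop :=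
  ∃ pn : Spec F × ℕ+, ℵ pn ≠ 0 ∧ pn ≠ (Spec.X, 1)

theorem jordanBlock_ne_zero (p : Spec F) (n : ℕ+) (h : (p, n) ≠ (Spec.X, 1)) :
    jordanBlock p n ≠ 0 := by
  intro h0
  have hnt : Nontrivial (AdjoinRoot p.1) :=
    AdjoinRoot.nontrivial p.1 (Polynomial.degree_pos_of_irreducible p.2.2).ne'
  by_cases hn : 1 < (n : ℕ)
  · have h1 := congrFun (LinearMap.congr_fun h0 (Pi.single ⟨1, hn⟩ 1)) ⟨0, n.pos⟩
    rw [jordanBlock_apply] at h1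
    simp [hn, Fin.ext_iff] at h1
  · have hn1 : n = 1 := by
      apply PNat.eq
      have := n.pos
      simp only [PNat.one_coe]
      omega
    have h1 := congrFun (LinearMap.congr_fun h0 (fun _ => 1)) ⟨0, n.pos⟩
    rw [jordanBlock_apply] at h1
    have h2 : AdjoinRoot.root p.1 = 0 := by simpa [hn] using h1
    have h3 : p.1 ∣ Polynomial.X := by
      rw [← AdjoinRoot.mk_eq_zero, AdjoinRoot.mk_X, h2]
    have h4 : p.1 = Polynomial.X :=
      Polynomial.eq_of_monic_of_associated p.2.1 Polynomial.monic_X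
        (p.2.2.associated_of_dvd Polynomial.irreducible_X h3)
    exact h (Prod.ext (Subtype.ext h4) hn1)

theorem MultFn.Nontriv.jordanForm_ne_zero {ℵ : MultFn.{u, w} F} (h : ℵ.Nontriv) :
    jordanForm ℵ ≠ 0 := by
  classical
  obtain ⟨pn, h1, h2⟩ := h
  intro h0
  have hne : Nonempty (ℵ pn).out := by
    rw [← Cardinal.mk_ne_zero_iff, Cardinal.mk_out]
    exact h1
  obtain ⟨α⟩ := hne
  refine jordanBlock_ne_zero pn.1 pn.2 h2 (LinearMap.ext fun y => ?_)
  let i : BlockIndex ℵ := ⟨pn, α⟩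
  have h3 := LinearMap.congr_fun h0
    (DirectSum.lof F (BlockIndex ℵ) (fun i => BlockSpace i.1.1 i.1.2) i y)
  have h4 : jordanForm ℵ (DirectSum.lof F (BlockIndex ℵ) (fun i => BlockSpace i.1.1 i.1.2) i y)
      = DirectSum.lof F (BlockIndex ℵ) (fun i => BlockSpace i.1.1 i.1.2) i
        (jordanBlock i.1.1 i.1.2 y) :=
    DirectSum.lmap_lof (fun i : BlockIndex ℵ => jordanBlock i.1.1 i.1.2) i y
  rw [h4, LinearMap.zero_apply] at h3
  exact DirectSum.of_injective (β := fun i : BlockIndex ℵ => BlockSpace i.1.1 i.1.2) i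
    (h3.trans (map_zero _).symm)

end Jordan

section Lie

/-- An almost Abelian Lie algebra: a non-Abelian Lie algebra with an Abelian subalgebra of
codimension one. -/
def IsAlmostAbelian (F : Type u) [Field F] (L : Type w) [LieRing L] [LieAlgebra F L] : Prop :=
  ¬ IsLieAbelian L ∧
    ∃ A : LieSubalgebra F L, IsLieAbelian A ∧ Module.finrank F (L ⧸ A.toSubmodule) = 1

/-- `L = F e₀ ⋊ V` with an Abelian ideal `V` of codimension one. -/
structure IsDecomposition {F : Type u} [Field F] {L : Type w} [LieRing L] [LieAlgebra F L]
    (e₀ : L) (V : LieIdeal F L) : Prop where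
  ne_zero : e₀ ≠ 0
  abelian : IsLieAbelian V
  isCompl : IsCompl (Submodule.span F {e₀}) V.toSubmodule

/-- The operator `ad_{e₀}` on the ideal `V`. -/
def adOn {F : Type u} [Field F] {L : Type w} [LieRing L] [LieAlgebra F L]
    (e₀ : L) (V : LieIdeal F L) : Module.End F V := LieModule.toEnd F L V e₀

/-- `L` can be written as `F e₀ ⋊ V` with a Jordanable operator `ad_{e₀}` on `V`. -/
def IsJordanableLie (F : Type u) [Field F] (L : Type w) [LieRing L] [LieAlgebra F L] : Prop :=
  ∃ (e₀ : L) (V : LieIdeal F L), IsDecomposition e₀ V ∧ IsJordanableOp.{u, w} (adOn e₀ V)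

/-- Jordanable almost Abelian Lie algebras over `F`. -/
structure JordanableAA (F : Type u) [Field F] where
  carrier : Type w
  [lieRing : LieRing carrier]
  [lieAlgebra : LieAlgebra F carrier]
  almostAbelian : IsAlmostAbelian F carrier
  jordanable : IsJordanableLie.{u, w} F carrier

attribute [instance] JordanableAA.lieRing JordanableAA.lieAlgebra

/-- Isomorphism of Lie algebras over `F`. -/
def isoSetoid (F : Type u) [Field F] : Setoid (JordanableAA.{u, w} F) where
  r L M := Nonempty (L.carrier ≃ₗ⁅F⁆ M.carrier)
  iseqv := ⟨fun _ => ⟨LieEquiv.refl⟩, fun ⟨e⟩ => ⟨e.symm⟩, fun ⟨e⟩ ⟨f⟩ => ⟨e.trans f⟩⟩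

/-- Isomorphism classes of Jordanable almost Abelian Lie algebras over `F`. -/
def IsoClass (F : Type u) [Field F] : Type (max u (w + 1)) := Quotient (isoSetoid.{u, w} F)

/-- The isomorphism class `[L]`. -/
def IsoClass.mk {F : Type u} [Field F] (L : JordanableAA.{u, w} F) : IsoClass.{u, w} F :=
  Quotient.mk (isoSetoid F) L

/-- Projective multiplicity functions: the orbits `F* ⋆ ℵ` of the action of `F*` on multiplicity
functions, for those `ℵ` with a block other than `J(X, 1) = 0`. -/
def ProjMult (F : Type u) [Field F] : Type (max u (w + 1)) :=
  {o : Set (MultFn.{u, w} F) // ∃ ℵ : MultFn.{u, w} F, ℵ.Nontriv ∧ o = MulAction.orbit Fˣ ℵ}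

/-- The projective multiplicity function `F* ⋆ ℵ`. -/
def ProjMult.mk {F : Type u} [Field F] (ℵ : MultFn.{u, w} F) (h : ℵ.Nontriv) :
    ProjMult.{u, w} F := ⟨MulAction.orbit Fˣ ℵ, ℵ, h, rfl⟩

/-- The underlying space `F e₀ ⊕ V` of the semidirect product defined by the operator `T` on the
Abelian Lie algebra `V`. -/
@[ext] structure Semidirect {F : Type u} [Field F] {V : Type x} [AddCommGroup V] [Module F V]
    (T : Module.End F V) : Type (max u x) where
  coord : F
  vec : V

namespace Semidirect

variable {F : Type u} [Field F] {V : Type x} [AddCommGroup V] [Module F V] {T : Module.End F V}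

/-- Identification of the underlying space with `F × V`. -/
def equivProd (T : Module.End F V) : Semidirect T ≃ F × V where
  toFun y := (y.coord, y.vec)
  invFun y := ⟨y.1, y.2⟩
  left_inv _ := rfl
  right_inv _ := rfl

instance : AddCommGroup (Semidirect T) := (equivProd T).addCommGroup

instance : Module F (Semidirect T) := (equivProd T).module F

@[simp] theorem add_coord (y z : Semidirect T) : (y + z).coord = y.coord + z.coord := rfl
@[simp] theorem add_vec (y z : Semidirect T) : (y + z).vec = y.vec + z.vec := rfl
@[simp] theorem zero_coord : (0 : Semidirect T).coord = 0 := rfl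
@[simp] theorem zero_vec : (0 : Semidirect T).vec = 0 := rfl
@[simp] theorem smul_coord (c : F) (y : Semidirect T) : (c • y).coord = c * y.coord := rfl
@[simp] theorem smul_vec (c : F) (y : Semidirect T) : (c • y).vec = c • y.vec := rfl

/-- The bracket of `F e₀ ⋊ V`:
`[a e₀ + y, b e₀ + z] = a T z - b T y`, that is, `[e₀, z] = T z` and `[y, z] = 0`. -/
instance : Bracket (Semidirect T) (Semidirect T) :=
  ⟨fun y z => ⟨0, y.coord • T z.vec - z.coord • T y.vec⟩⟩

@[simp] theorem lie_coord (y z : Semidirect T) : ⁅y, z⁆.coord = 0 := rfl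
@[simp] theorem lie_vec (y z : Semidirect T) :
    ⁅y, z⁆.vec = y.coord • T z.vec - z.coord • T y.vec := rfl

instance : LieRing (Semidirect T) where
  add_lie y z t := by
    ext
    · simp
    · simp only [lie_vec, add_vec, add_coord, map_add, add_smul, smul_add]
      abel
  lie_add y z t := by
    ext
    · simp
    · simp only [lie_vec, add_vec, add_coord, map_add, add_smul, smul_add]
      abel
  lie_self y := by
    ext <;> simp
  leibniz_lie y z t := by
    ext
    · simp
    · simp only [lie_vec, add_vec, lie_coord, map_sub, map_smul, zero_smul, smul_sub, sub_zero,
        zero_sub, smul_smul, mul_comm z.coord y.coord, mul_comm t.coord y.coord,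
        mul_comm t.coord z.coord]
      abel

instance : LieAlgebra F (Semidirect T) where
  lie_smul c y z := by
    ext
    · simp
    · simp only [lie_vec, smul_vec, smul_coord, map_smul, smul_sub, smul_smul,
        mul_comm y.coord c]

/-- The element `e₀`. -/
def e0 (T : Module.End F V) : Semidirect T := ⟨1, 0⟩

/-- The Abelian ideal `V`. -/
def ideal (T : Module.End F V) : LieIdeal F (Semidirect T) where
  carrier := {y | y.coord = 0}
  add_mem' := by
    intro y z hy hz
    simp only [Set.mem_ofPred_eq] at hy hz ⊢
    simp [hy, hz]
  zero_mem' := rfl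
  smul_mem' := by
    intro c y hy
    simp only [Set.mem_ofPred_eq] at hy ⊢
    simp [hy]
  lie_mem := by
    intro y z _
    rfl

theorem mem_ideal (y : Semidirect T) : y ∈ ideal T ↔ y.coord = 0 := Iff.rfl

/-- The ideal is `V`, as a vector space. -/
def idealEquiv (T : Module.End F V) : ideal T ≃ₗ[F] V where
  toFun y := y.1.vec
  invFun y := ⟨⟨0, y⟩, rfl⟩
  map_add' _ _ := rfl
  map_smul' _ _ := rfl
  left_inv y := by
    apply Subtype.ext
    apply Semidirect.ext
    · exact ((mem_ideal _).1 y.2).symm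
    · rfl
  right_inv _ := rfl

theorem idealEquiv_ad (y : ideal T) : idealEquiv T (adOn (e0 T) (ideal T) y)
    = T (idealEquiv T y) := by
  change (⁅e0 T, (y : Semidirect T)⁆).vec = T (y : Semidirect T).vec
  simp [e0]

theorem isLieAbelian_ideal : IsLieAbelian (ideal T) := by
  refine ⟨fun y z => Subtype.ext ?_⟩
  change ⁅(y : Semidirect T), (z : Semidirect T)⁆ = 0
  have hy := (mem_ideal _).1 y.2
  have hz := (mem_ideal _).1 z.2
  ext <;> simp [hy, hz]

theorem isDecomposition : IsDecomposition (e0 T) (ideal T) where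
  ne_zero h := one_ne_zero (congrArg Semidirect.coord h)
  abelian := isLieAbelian_ideal
  isCompl := by
    constructor
    · rw [Submodule.disjoint_def]
      intro y hy hy2
      obtain ⟨c, rfl⟩ := Submodule.mem_span_singleton.1 hy
      have hc : (c • e0 T).coord = 0 := hy2
      have hc0 : c = 0 := by simpa [e0] using hc
      rw [hc0, zero_smul]
    · rw [codisjoint_iff, Submodule.eq_top_iff']
      intro y
      rw [Submodule.mem_sup]
      refine ⟨y.coord • e0 T, Submodule.mem_span_singleton.2 ⟨_, rfl⟩, ⟨0, y.vec⟩, rfl, ?_⟩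
      ext <;> simp [e0]

theorem isAlmostAbelian (hT : T ≠ 0) : IsAlmostAbelian F (Semidirect T) := by
  refine ⟨fun h => hT ?_, (ideal T).toLieSubalgebra, isLieAbelian_ideal, ?_⟩
  · ext y
    have h1 : ⁅e0 T, (⟨0, y⟩ : Semidirect T)⁆ = 0 := h.trivial _ _
    have h2 := congrArg Semidirect.vec h1
    simpa [e0] using h2
  · have e := Submodule.quotientEquivOfIsCompl _ _ (isDecomposition (T := T)).isCompl.symm
    change Module.finrank F (Semidirect T ⧸ (ideal T).toSubmodule) = 1
    rw [e.finrank_eq]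
    exact finrank_span_singleton (isDecomposition (T := T)).ne_zero

end Semidirect

/-- The Lie algebra `aA(ℵ) = F e₀ ⋊ V` with `ad_{e₀} = J(ℵ)`. -/
def aA {F : Type u} [Field F] (ℵ : MultFn.{u, max u v} F) (h : ℵ.Nontriv) :
    JordanableAA.{u, max u v} F where
  carrier := Semidirect (jordanForm ℵ)
  almostAbelian := Semidirect.isAlmostAbelian h.jordanForm_ne_zero
  jordanable := ⟨Semidirect.e0 _, Semidirect.ideal _, Semidirect.isDecomposition,
    ℵ, Semidirect.idealEquiv _, Semidirect.idealEquiv_ad⟩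

end Lie

end AlmostAbelian

end

noncomputable section

namespace AlmostAbelian

/-! The theorem rests on two facts: an operator determines its multiplicity function, and the Lie
algebra determines the operator up to similarity and a nonzero factor.

For the first, the number ℵ(p, n) is recovered from T alone. The space ker p(T) ∩ im p(T)^(n-1),
modulo its intersection with im p(T)^n, is a direct sum of ℵ(p, n) copies of F_p, so its dimension
is ℵ(p, n) · deg p, and the finite factor deg p cancels (`multFn_eq_of_similar`). The computation is
done block by block. By Taylor expansion p(x_q + N) = p(x_q) + (p'(x_q) + kN)N. For q ≠ p this is
invertible. For q = p the constant term vanishes while p'(x_p) ≠ 0, because p is separable over a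
perfect field; so p(J(p, n)) is N times a commuting unit (`exists_aeval_jordanBlock`).

For the second, let L = Fe₀ + V = Fe₀' + V'. If V = V', then e₀ is a multiple of e₀' modulo V, and V
acts on itself by zero. If V ≠ V', both operators have rank at most one, and an explicit map
exchanging V and V' conjugates them (`IsDecomposition.projSimilar`). Conversely, a factor c is
absorbed by rescaling e₀ (`Semidirect.congr`).

The factor becomes the action on ℵ because c J(ℵ) is similar to J(c ⋆ ℵ)
(`hasJordanForm_smul_jordanForm`). Hence isomorphism classes correspond to orbits. -/

/-- Taylor expansion to first order at commuting elements of a noncommutative algebra. -/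
theorem exists_aeval_add_eq {R A : Type*} [CommRing R] [Ring A] [Algebra R A] {a b : A}
    (h : Commute a b) (p : R[X]) :
    ∃ k : A, Commute k b ∧ Commute k a ∧
      aeval (a + b) p = aeval a p + (aeval a (derivative p) + k * b) * b := by
  have hc : ∀ q : R[X], Commute (aeval a q) b := by
    intro q
    induction q using Polynomial.induction_on' with
    | add f g hf hg => rw [map_add]; exact hf.add_left hg
    | monomial n r =>
      rw [aeval_monomial]
      exact (Algebra.commute_algebraMap_left r b).mul_left (h.pow_left n)
  -- The expansion holds in the commutative ring `R[X][X]` and is carried to `A` by sending the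
  -- inner variable to `a` and the outer one to `b`. The remainder comes from that ring, so its
  -- image commutes with both.
  let Ψ : R[X][X] →ₐ[R] A := eval₂AlgHom (aeval a) b hc
  have hX : Ψ Polynomial.X = b := by simp [Ψ]
  have hC : ∀ q : R[X], Ψ (Polynomial.C q) = aeval a q := by intro q; simp [Ψ]
  have hCX : Ψ (Polynomial.C Polynomial.X) = a := by rw [hC, aeval_X]
  obtain ⟨k, hk⟩ := binomExpansion (p.map (algebraMap R R[X][X])) (Polynomial.C Polynomial.X)
    Polynomial.X
  rw [derivative_map, eval_map_algebraMap, eval_map_algebraMap, eval_map_algebraMap] at hk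
  refine ⟨Ψ k, ?_, ?_, ?_⟩
  · rw [← hX]; exact (Commute.all k _).map Ψ
  · rw [← hCX]; exact (Commute.all k _).map Ψ
  · have h2 := congrArg Ψ hk
    simp only [map_add, map_mul, map_pow, ← aeval_algHom_apply, hX, hCX] at h2
    rw [h2]
    noncomm_ring

/-- `S` need not be invertible: this serves both for similarities and for the projection of J(ℵ)
onto a single block. -/
theorem aeval_intertwine {F : Type*} [Field F] {V W : Type*} [AddCommGroup V] [Module F V]
    [AddCommGroup W] [Module F W] {T : Module.End F V} {T' : Module.End F W} (S : V →ₗ[F] W)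
    (h : ∀ y, S (T y) = T' (S y)) (p : F[X]) (y : V) :
    S (aeval T p y) = aeval T' p (S y) := by
  have hpow : ∀ (n : ℕ) (y : V), S ((T ^ n) y) = (T' ^ n) (S y) := by
    intro n
    induction n with
    | zero => intro y; rfl
    | succ n ih => intro y; rw [pow_succ, pow_succ, Module.End.mul_apply, Module.End.mul_apply, ih, h]
  induction p using Polynomial.induction_on' with
  | add f g hf hg => simp [hf, hg]
  | monomial n r => simp [aeval_monomial, hpow, Module.algebraMap_end_apply]

/-! ### Polynomials evaluated at a single Jordan block -/

section Block

variable {F : Type u} [Field F]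

instance (p : Spec F) : Fact (Irreducible p.1) := ⟨p.2.2⟩

theorem nilBlock_pow_apply (p : Spec F) (n : ℕ+) (k : ℕ) (v : BlockSpace p n) (m : Fin n) :
    (nilBlock p n ^ k) v m = if h : (m : ℕ) + k < n then v ⟨m + k, h⟩ else 0 := by
  induction k generalizing v with
  | zero => simp
  | succ k ih =>
    rw [pow_succ, Module.End.mul_apply, ih]
    by_cases h : (m : ℕ) + k < n
    · simp [h, nilBlock, add_assoc]
    · have h' : ¬ (m : ℕ) + (k + 1) < n := by omega
      simp [h, h']

theorem nilBlock_pow_self (p : Spec F) (n : ℕ+) : nilBlock p n ^ (n : ℕ) = 0 := by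
  ext v m
  rw [LinearMap.comp_apply, nilBlock_pow_apply]
  simp

/-- Multiplication by a scalar of `F_p`, on `F_p ^ n`. -/
def scalarBlock (p : Spec F) (n : ℕ+) : AdjoinRoot p.1 →ₐ[F] Module.End F (BlockSpace p n) :=
  Algebra.lsmul F F (BlockSpace p n)

theorem scalarBlock_apply (p : Spec F) (n : ℕ+) (a : AdjoinRoot p.1) (v : BlockSpace p n)
    (m : Fin n) : scalarBlock p n a v m = a * v m := rfl

theorem commute_scalarBlock_nilBlock (p : Spec F) (n : ℕ+) (a : AdjoinRoot p.1) :
    Commute (scalarBlock p n a) (nilBlock p n) := by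
  refine LinearMap.ext fun v => funext fun m => ?_
  by_cases h : (m : ℕ) + 1 < n <;> simp [scalarBlock_apply, nilBlock, h]

theorem jordanBlock_eq (p : Spec F) (n : ℕ+) :
    jordanBlock p n = scalarBlock p n (AdjoinRoot.root p.1) + nilBlock p n := rfl

theorem aeval_root_eq_zero_iff (p q : Spec F) :
    aeval (AdjoinRoot.root q.1) p.1 = 0 ↔ q = p := by
  rw [AdjoinRoot.aeval_eq, AdjoinRoot.mk_eq_zero]
  constructor
  · intro h
    exact Subtype.ext (eq_of_monic_of_associated q.2.1 p.2.1 (q.2.2.associated_of_dvd p.2.2 h))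
  · rintro rfl
    exact dvd_rfl

theorem isUnit_scalarBlock (p : Spec F) (n : ℕ+) {a : AdjoinRoot p.1} (ha : a ≠ 0) :
    IsUnit (scalarBlock p n a) := (IsUnit.mk0 a ha).map (scalarBlock p n)

/-- A unit plus a commuting nilpotent is a unit. -/
theorem isUnit_scalarBlock_add (p : Spec F) (n : ℕ+) {a : AdjoinRoot p.1} (ha : a ≠ 0)
    {c : Module.End F (BlockSpace p n)} (hc : Commute c (nilBlock p n))
    (hca : Commute c (scalarBlock p n a)) :
    IsUnit (scalarBlock p n a + c * nilBlock p n) := by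
  refine IsNilpotent.isUnit_add_left_of_commute ⟨n, ?_⟩ (isUnit_scalarBlock p n ha) ?_
  · rw [hc.mul_pow, nilBlock_pow_self, mul_zero]
  · exact hca.mul_left (commute_scalarBlock_nilBlock p n a).symm

open Classical in
/-- Evaluated at the Jordan block `J(q, n)`, the polynomial `p` is invertible for `q ≠ p` and
generates the same kernels and ranges as the nilpotent block for `q = p`. -/
theorem exists_aeval_jordanBlock [PerfectField F] (p q : Spec F) (n : ℕ+) :
    ∃ U : Module.End F (BlockSpace q n), IsUnit U ∧
      Commute (if q = p then nilBlock q n else 1) U ∧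
      aeval (jordanBlock q n) p.1 = (if q = p then nilBlock q n else 1) * U := by
  set r := AdjoinRoot.root q.1
  have hcomm := commute_scalarBlock_nilBlock q n
  obtain ⟨k, hk, hkr, h⟩ := exists_aeval_add_eq (hcomm r) p.1
  rw [← jordanBlock_eq, aeval_algHom_apply, aeval_algHom_apply] at h
  have hk' : ∀ f : F[X], Commute k (scalarBlock q n (aeval r f)) := by
    intro f
    rw [← aeval_algHom_apply]
    induction f using Polynomial.induction_on' with
    | add f g hf hg => rw [map_add]; exact hf.add_right hg
    | monomial m c =>
      rw [aeval_monomial]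
      exact (Algebra.commute_algebraMap_right c k).mul_right (hkr.pow_right m)
  by_cases hqp : q = p
  · simp only [if_pos hqp]
    have h0 := (aeval_root_eq_zero_iff p q).2 hqp
    have hd : aeval r (derivative p.1) ≠ 0 := by
      intro h1
      -- Perfectness enters here: evaluating the Bézout relation between p and p' at a common root
      -- would give 0 = 1.
      obtain ⟨a, b, hab⟩ := PerfectField.separable_of_irreducible p.2.2
      have h2 := congrArg (aeval r) hab
      rw [map_add, map_mul, map_mul, h1, h0] at h2
      simp at h2
    have hU : Commute (scalarBlock q n (aeval r (derivative p.1)) + k * nilBlock q n)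
        (nilBlock q n) := (hcomm _).add_left (hk.mul_left (Commute.refl _))
    refine ⟨_, isUnit_scalarBlock_add q n hd hk (hk' _), hU.symm, ?_⟩
    rw [h, h0, map_zero, zero_add]
    exact hU
  · simp only [if_neg hqp]
    have h0 : aeval r p.1 ≠ 0 := fun h1 => hqp ((aeval_root_eq_zero_iff p q).1 h1)
    refine ⟨_, ?_, Commute.one_left _, (one_mul _).symm⟩
    rw [h]
    refine isUnit_scalarBlock_add q n h0 ?_ ?_
    · exact (hcomm _).add_left (hk.mul_left (Commute.refl _))
    · refine Commute.add_left ?_ ((hk' _).mul_left (hcomm _).symm)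
      exact (Commute.all _ _).map (scalarBlock q n)

/-! ### The subquotient that counts blocks, on a single block -/

section Subquotient

variable (p : Spec F) (n : ℕ+)

-- A commuting unit factor changes neither the kernel nor the ranges of powers, so p(J(q, n)) may be
-- replaced by the shift N, or by 1 when q ≠ p.
open Classical in
theorem mem_ker_range_aeval_jordanBlock [PerfectField F] (q : Spec F) (k : ℕ) (v : BlockSpace q n) :
    (aeval (jordanBlock q n) p.1 v = 0 ↔ (if q = p then nilBlock q n else 1) v = 0) ∧
    ((∃ z, (aeval (jordanBlock q n) p.1 ^ k) z = v) ↔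
      ∃ z, ((if q = p then nilBlock q n else 1) ^ k) z = v) := by
  obtain ⟨U, hU, hc, h⟩ := exists_aeval_jordanBlock p q n
  rw [h]
  obtain ⟨U, rfl⟩ := hU
  constructor
  · have hinj : ∀ y, (U : Module.End F (BlockSpace q n)) y = 0 → y = 0 := by
      intro y hy
      have : ((U⁻¹ * U : (Module.End F (BlockSpace q n))ˣ) : Module.End F (BlockSpace q n)) y = 0 := by
        rw [Units.val_mul, Module.End.mul_apply, hy, map_zero]
      simpa using this
    rw [hc.eq, Module.End.mul_apply]
    exact ⟨hinj _, fun h => by rw [h, map_zero]⟩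
  · rw [hc.mul_pow]
    constructor
    · rintro ⟨z, hz⟩
      exact ⟨_, hz⟩
    · rintro ⟨z, hz⟩
      refine ⟨((U ^ k)⁻¹ : (Module.End F (BlockSpace q n))ˣ).val z, ?_⟩
      rw [Module.End.mul_apply, ← Module.End.mul_apply _ _ z, ← Units.val_pow_eq_pow_val,
        ← Units.val_mul, mul_inv_cancel, Units.val_one, Module.End.one_apply, hz]

variable {p n}

/-- Coordinate j of v is coordinate j - 1 of N v, so a kernel vector of N lives in coordinate 0. -/
theorem eq_zero_of_nilBlock_apply_eq_zero {q : Spec F} {m : ℕ+} {v : BlockSpace q m}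
    (h : nilBlock q m v = 0) {j : Fin m} (hj : (j : ℕ) ≠ 0) : v j = 0 := by
  have h1 := congrFun h ⟨j - 1, by omega⟩
  have h2 : (j : ℕ) - 1 + 1 < m := by omega
  have h3 : (⟨(j : ℕ) - 1 + 1, h2⟩ : Fin m) = j := Fin.ext (by simp only; omega)
  simpa [nilBlock, h2, h3] using h1

/-- Blocks of any other type contribute nothing to the subquotient attached to (p, n). -/
theorem mem_range_pow_of_ne [PerfectField F] {q : Spec F} {m : ℕ+} (hne : (q, m) ≠ (p, n)) {v : BlockSpace q m}
    (hker : aeval (jordanBlock q m) p.1 v = 0)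
    (hran : ∃ z, (aeval (jordanBlock q m) p.1 ^ ((n : ℕ) - 1)) z = v) :
    ∃ z, (aeval (jordanBlock q m) p.1 ^ (n : ℕ)) z = v := by
  classical
  rw [(mem_ker_range_aeval_jordanBlock p m q 0 v).1] at hker
  rw [(mem_ker_range_aeval_jordanBlock p m q _ v).2] at hran ⊢
  by_cases hqp : q = p
  · simp only [if_pos hqp] at *
    have hmn : (m : ℕ) ≠ n := fun h => hne (Prod.ext hqp (PNat.eq h))
    obtain ⟨z, hz⟩ := hran
    have h0 := fun j : Fin m => eq_zero_of_nilBlock_apply_eq_zero hker (j := j)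
    have hn := n.pos
    by_cases hlt : (m : ℕ) < n
    · refine ⟨0, ?_⟩
      rw [map_zero, ← hz]
      funext j
      rw [nilBlock_pow_apply, dif_neg (by omega)]
      rfl
    -- Here m > n, so coordinate n exists and N^n moves it to coordinate 0, the only one where v can
    -- be nonzero.
    · refine ⟨Pi.single ⟨n, by omega⟩ (v ⟨0, m.pos⟩), ?_⟩
      funext j
      rw [nilBlock_pow_apply]
      by_cases hj : (j : ℕ) = 0
      · have hj' : j = ⟨0, m.pos⟩ := Fin.ext hj
        subst hj'
        rw [dif_pos (by simp only; omega)]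
        simp
      · rw [h0 j hj]
        split_ifs with h
        · rw [Pi.single_eq_of_ne]
          intro h'
          have := congrArg Fin.val h'
          simp only at this
          omega
        · rfl
  · simp only [if_neg hqp, one_pow] at *
    exact ⟨v, rfl⟩

/-- On a block of type (p, n) the n-th power vanishes, and a kernel vector is determined by its
coordinate 0. -/
theorem apply_zero_eq_zero_iff [PerfectField F] {v : BlockSpace p n} (hker : aeval (jordanBlock p n) p.1 v = 0) :
    v ⟨0, n.pos⟩ = 0 ↔ ∃ z, (aeval (jordanBlock p n) p.1 ^ (n : ℕ)) z = v := by
  classical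
  rw [(mem_ker_range_aeval_jordanBlock p n p 0 v).1, if_pos rfl] at hker
  rw [(mem_ker_range_aeval_jordanBlock p n p _ v).2, if_pos rfl, nilBlock_pow_self]
  constructor
  · intro h
    refine ⟨0, ?_⟩
    funext j
    by_cases hj : (j : ℕ) = 0
    · have hj' : j = ⟨0, n.pos⟩ := Fin.ext hj
      rw [hj', h]
      rfl
    · rw [eq_zero_of_nilBlock_apply_eq_zero hker hj]
      rfl
  · rintro ⟨z, rfl⟩
    rfl

/-- Every value of the leading coordinate is attained: N^(n-1) moves the last coordinate to the
first. -/
theorem single_zero_mem [PerfectField F] (a : AdjoinRoot p.1) :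
    aeval (jordanBlock p n) p.1 (Pi.single ⟨0, n.pos⟩ a : BlockSpace p n) = 0 ∧
    ∃ z, (aeval (jordanBlock p n) p.1 ^ ((n : ℕ) - 1)) z =
      (Pi.single ⟨0, n.pos⟩ a : BlockSpace p n) := by
  classical
  have hn := n.pos
  rw [(mem_ker_range_aeval_jordanBlock p n p 0 _).1, if_pos rfl,
    (mem_ker_range_aeval_jordanBlock p n p _ _).2, if_pos rfl]
  constructor
  · funext j
    rw [← pow_one (nilBlock p n), nilBlock_pow_apply]
    split_ifs with h
    · rw [Pi.single_eq_of_ne (fun h => by simpa using congrArg Fin.val h)]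
      rfl
    · rfl
  · refine ⟨Pi.single ⟨n - 1, by omega⟩ a, ?_⟩
    funext j
    rw [nilBlock_pow_apply]
    by_cases hj : (j : ℕ) = 0
    · have hj' : j = ⟨0, n.pos⟩ := Fin.ext hj
      subst hj'
      rw [dif_pos (by simp only; omega)]
      simp
    · rw [dif_neg (by omega), Pi.single_eq_of_ne]
      exact fun h => hj (congrArg Fin.val h)

end Subquotient

end Block

/-! ### Recovering a cardinal from a dimension -/

theorem nonempty_linearEquiv_of_ker_eq {R M A B : Type*} [Ring R] [AddCommGroup M] [Module R M]
    [AddCommGroup A] [Module R A] [AddCommGroup B] [Module R B] (f : M →ₗ[R] A) (g : M →ₗ[R] B)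
    (hf : Function.Surjective f) (hg : Function.Surjective g)
    (h : LinearMap.ker f = LinearMap.ker g) : Nonempty (A ≃ₗ[R] B) :=
  ⟨(f.quotKerEquivOfSurjective hf).symm.trans
    ((Submodule.quotEquivOfEq _ _ h).trans (g.quotKerEquivOfSurjective hg))⟩

/-- Multiplying by `d` preserves finiteness and infiniteness. Finite cardinals cancel in ℕ, and an
infinite cardinal absorbs `d`. -/
theorem cardinal_eq_of_mul_eq {a b d : Cardinal.{w}} (hd : d ≠ 0) (hd' : d < Cardinal.aleph0)
    (h : a * d = b * d) : a = b := by
  have hle : ∀ {a b : Cardinal.{w}}, a * d = b * d → a < Cardinal.aleph0 →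
      b < Cardinal.aleph0 := fun {a b} h ha =>
    (Cardinal.le_mul_right hd).trans_lt (h ▸ Cardinal.mul_lt_aleph0 ha hd')
  by_cases ha : a < Cardinal.aleph0
  · have hb := hle h ha
    lift a to ℕ using ha
    lift b to ℕ using hb
    lift d to ℕ using hd'
    norm_cast at h hd ⊢
    exact Nat.eq_of_mul_eq_mul_right (Nat.pos_of_ne_zero hd) h
  · have hb : ¬ b < Cardinal.aleph0 := fun hb => ha (hle h.symm hb)
    rw [not_lt] at ha hb
    rwa [Cardinal.mul_eq_left ha (hd'.le.trans ha) hd,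
      Cardinal.mul_eq_left hb (hd'.le.trans hb) hd] at h

theorem cardinal_eq_of_finsupp_linearEquiv {F : Type u} [Field F] {K : Type v} [AddCommGroup K]
    [Module F K] [FiniteDimensional F K] [Nontrivial K] {A B : Type w}
    (e : (A →₀ K) ≃ₗ[F] (B →₀ K)) : Cardinal.mk A = Cardinal.mk B := by
  have h := e.rank_eq
  rw [rank_finsupp, rank_finsupp] at h
  refine Cardinal.lift_injective (cardinal_eq_of_mul_eq ?_ ?_ h)
  · rw [Ne, Cardinal.lift_eq_zero, rank_zero_iff]
    exact fun h => not_subsingleton K h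
  · rw [Cardinal.lift_lt_aleph0]
    exact Module.rank_lt_aleph0 F K

/-! ### An operator determines its multiplicity function -/

section Uniqueness

variable {F : Type u} [Field F]

theorem aeval_jordanForm_apply (ℵ : MultFn.{u, w} F) (f : F[X]) (y : JordanSpace ℵ)
    (i : BlockIndex ℵ) :
    aeval (jordanForm ℵ) f y i = aeval (jordanBlock i.1.1 i.1.2) f (y i) :=
  aeval_intertwine (T := jordanForm ℵ) (T' := jordanBlock i.1.1 i.1.2)
    (DirectSum.component F (BlockIndex ℵ) (fun i => BlockSpace i.1.1 i.1.2) i)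
    (fun _ => rfl) f y

theorem mem_range_aeval_jordanForm {ℵ : MultFn.{u, w} F} {f : F[X]} {y : JordanSpace ℵ} :
    (∃ z, aeval (jordanForm ℵ) f z = y) ↔
      ∀ i, ∃ z, aeval (jordanBlock i.1.1 i.1.2) f z = y i := by
  classical
  constructor
  · rintro ⟨z, rfl⟩ i
    exact ⟨z i, (aeval_jordanForm_apply ℵ f z i).symm⟩
  · intro h
    choose z hz using h
    change y ∈ LinearMap.range (aeval (jordanForm ℵ) f)
    -- The chosen preimages may be nonzero outside the support of y, so the finitely many components
    -- of y are lifted one at a time.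
    rw [← DirectSum.sum_support_of y]
    refine Submodule.sum_mem _ fun i _ => ⟨DirectSum.of _ i (z i), ?_⟩
    refine DFinsupp.ext fun j => ?_
    rw [aeval_jordanForm_apply]
    by_cases hij : i = j
    · subst hij
      rw [DirectSum.of_eq_same, DirectSum.of_eq_same, hz]
    · rw [DirectSum.of_eq_of_ne _ _ _ (Ne.symm hij), DirectSum.of_eq_of_ne _ _ _ (Ne.symm hij),
        map_zero]

/-- The block of type `(p, n)` with a given label. -/
def blockAt (ℵ : MultFn.{u, w} F) (pn : Spec F × ℕ+) (α : (ℵ pn).out) : BlockIndex ℵ := ⟨pn, α⟩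

theorem blockAt_injective (ℵ : MultFn.{u, w} F) (pn : Spec F × ℕ+) :
    Function.Injective (blockAt ℵ pn) :=
  fun _ _ h => eq_of_heq (Sigma.mk.inj h).2

/-- The leading coordinates of the blocks of type `(p, n)`. -/
def leading (ℵ : MultFn.{u, w} F) (pn : Spec F × ℕ+) :
    JordanSpace ℵ →ₗ[F] Π₀ _ : (ℵ pn).out, AdjoinRoot pn.1.1 where
  toFun y := (DFinsupp.comapDomain (blockAt ℵ pn) (blockAt_injective ℵ pn) y).mapRange
    (fun _ (v : BlockSpace pn.1 pn.2) => v ⟨0, pn.2.pos⟩) (fun _ => rfl)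
  map_add' _ _ := DFinsupp.ext fun _ => rfl
  map_smul' _ _ := DFinsupp.ext fun _ => rfl

theorem leading_apply (ℵ : MultFn.{u, w} F) (pn : Spec F × ℕ+) (y : JordanSpace ℵ)
    (α : (ℵ pn).out) : leading ℵ pn y α =
      (y (blockAt ℵ pn α) : BlockSpace pn.1 pn.2) ⟨0, pn.2.pos⟩ := rfl

/-- The intersection of the kernel of `p(T)` and the range of `p(T) ^ (n - 1)`. -/
def kerRange {V : Type*} [AddCommGroup V] [Module F V] (T : Module.End F V)
    (pn : Spec F × ℕ+) : Submodule F V :=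
  LinearMap.ker (aeval T pn.1.1) ⊓ LinearMap.range (aeval T (pn.1.1 ^ ((pn.2 : ℕ) - 1)))

/-- The right-hand side mentions only the operator, so the kernel of `leading` on `kerRange` is
invariant under similarity. -/
theorem leading_eq_zero_iff [PerfectField F] {ℵ : MultFn.{u, w} F} {pn : Spec F × ℕ+}
    {y : JordanSpace ℵ} (hy : y ∈ kerRange (jordanForm ℵ) pn) :
    leading ℵ pn y = 0 ↔ ∃ z, aeval (jordanForm ℵ) (pn.1.1 ^ (pn.2 : ℕ)) z = y := by
  obtain ⟨hker, hran⟩ := hy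
  have hker' : ∀ i : BlockIndex ℵ, aeval (jordanBlock i.1.1 i.1.2) pn.1.1 (y i) = 0 := by
    intro i
    rw [← aeval_jordanForm_apply, LinearMap.mem_ker.1 hker]
    rfl
  have hran' := mem_range_aeval_jordanForm.1 hran
  rw [mem_range_aeval_jordanForm]
  simp only [map_pow] at hran' ⊢
  constructor
  · rintro h ⟨pn', α⟩
    by_cases hpn : pn' = pn
    · subst hpn
      exact (apply_zero_eq_zero_iff (hker' ⟨pn', α⟩)).1 (DFunLike.congr_fun h α)
    · exact mem_range_pow_of_ne hpn (hker' ⟨pn', α⟩) (hran' ⟨pn', α⟩)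
  · intro h
    exact DFinsupp.ext fun α =>
      (apply_zero_eq_zero_iff (hker' (blockAt ℵ pn α))).2 (h (blockAt ℵ pn α))

theorem exists_leading_eq [PerfectField F] (ℵ : MultFn.{u, w} F) (pn : Spec F × ℕ+)
    (a : Π₀ _ : (ℵ pn).out, AdjoinRoot pn.1.1) :
    ∃ y ∈ kerRange (jordanForm ℵ) pn, leading ℵ pn y = a := by
  classical
  -- The image is a subspace, so it is enough to reach vectors supported on one block.
  suffices h : (kerRange (jordanForm ℵ) pn).map (leading ℵ pn) = ⊤ by
    have : a ∈ (kerRange (jordanForm ℵ) pn).map (leading ℵ pn) := h ▸ Submodule.mem_top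
    exact this
  rw [Submodule.eq_top_iff']
  intro a
  induction a using DFinsupp.induction with
  | h0 => exact Submodule.zero_mem _
  | ha α b f _ _ hf =>
    refine Submodule.add_mem _ ?_ hf
    obtain ⟨h1, h2⟩ := single_zero_mem (p := pn.1) (n := pn.2) b
    let y : JordanSpace ℵ := DirectSum.of (fun i : BlockIndex ℵ => BlockSpace i.1.1 i.1.2)
      (blockAt ℵ pn α) (Pi.single ⟨0, pn.2.pos⟩ b : BlockSpace pn.1 pn.2)
    have hy : y (blockAt ℵ pn α) = (Pi.single ⟨0, pn.2.pos⟩ b : BlockSpace pn.1 pn.2) :=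
      DirectSum.of_eq_same (β := fun i : BlockIndex ℵ => BlockSpace i.1.1 i.1.2) _ _
    have hy' : ∀ j, j ≠ blockAt ℵ pn α → y j = 0 := fun j hj =>
      DirectSum.of_eq_of_ne (β := fun i : BlockIndex ℵ => BlockSpace i.1.1 i.1.2) _ _ _ hj
    refine ⟨y, ⟨?_, ?_⟩, ?_⟩
    · refine LinearMap.mem_ker.2 (DFinsupp.ext fun j => ?_)
      rw [aeval_jordanForm_apply]
      by_cases hj : j = blockAt ℵ pn α
      · subst hj
        rw [hy]
        exact h1
      · rw [hy' j hj, map_zero]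
        rfl
    · refine mem_range_aeval_jordanForm.2 fun j => ?_
      by_cases hj : j = blockAt ℵ pn α
      · subst hj
        rw [hy, map_pow]
        exact h2
      · rw [hy' j hj]
        exact ⟨0, map_zero _⟩
    · refine DFinsupp.ext fun β => ?_
      rw [leading_apply]
      by_cases hβ : β = α
      · subst hβ
        rw [hy, DFinsupp.single_eq_same]
        exact Pi.single_eq_same _ _
      · rw [hy' _ (fun h => hβ (blockAt_injective ℵ pn h)), DFinsupp.single_eq_of_ne hβ]
        rfl

section Transport

variable {V W : Type*} [AddCommGroup V] [Module F V] [AddCommGroup W] [Module F W]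
  {T : Module.End F V} {T' : Module.End F W} (S : V ≃ₗ[F] W)

theorem exists_aeval_eq_iff (hS : ∀ y, S (T y) = T' (S y)) (f : F[X]) (y : V) :
    (∃ z, aeval T f z = y) ↔ ∃ z, aeval T' f z = S y := by
  have hP : ∀ y, S (aeval T f y) = aeval T' f (S y) := aeval_intertwine (S : V →ₗ[F] W) hS f
  rw [S.surjective.exists]
  simp only [← hP, S.injective.eq_iff]

theorem mem_kerRange_iff (hS : ∀ y, S (T y) = T' (S y)) (pn : Spec F × ℕ+) (y : V) :
    y ∈ kerRange T pn ↔ S y ∈ kerRange T' pn := by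
  have hP : ∀ y, S (aeval T pn.1.1 y) = aeval T' pn.1.1 (S y) :=
    aeval_intertwine (S : V →ₗ[F] W) hS _
  refine and_congr ?_ (exists_aeval_eq_iff S hS _ y)
  change aeval T pn.1.1 y = 0 ↔ aeval T' pn.1.1 (S y) = 0
  rw [← hP, LinearEquiv.map_eq_zero_iff]

end Transport

/-- Once K' is identified with K through S, both A and B are the quotient of K by the same subspace.
-/
theorem nonempty_linearEquiv_of_restrict {V W A B : Type*} [AddCommGroup V] [Module F V]
    [AddCommGroup W] [Module F W] [AddCommGroup A] [Module F A] [AddCommGroup B] [Module F B]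
    (S : V ≃ₗ[F] W) {K : Submodule F V} {K' : Submodule F W} (hK : ∀ y, y ∈ K ↔ S y ∈ K')
    (f : V →ₗ[F] A) (g : W →ₗ[F] B) (hf : ∀ a, ∃ y ∈ K, f y = a) (hg : ∀ b, ∃ y ∈ K', g y = b)
    (h : ∀ y ∈ K, f y = 0 ↔ g (S y) = 0) : Nonempty (A ≃ₗ[F] B) := by
  refine nonempty_linearEquiv_of_ker_eq (f ∘ₗ K.subtype) (g ∘ₗ S.toLinearMap ∘ₗ K.subtype)
    (fun a => ?_) (fun b => ?_) (Submodule.ext fun y => h y.1 y.2)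
  · obtain ⟨y, hy, h⟩ := hf a
    exact ⟨⟨y, hy⟩, h⟩
  · obtain ⟨y, hy, h⟩ := hg b
    obtain ⟨y, rfl⟩ := S.surjective y
    exact ⟨⟨y, (hK y).2 hy⟩, h⟩

theorem multFn_eq_of_similar [PerfectField F] {ℵ ℵ' : MultFn.{u, w} F}
    (S : JordanSpace ℵ ≃ₗ[F] JordanSpace ℵ')
    (hS : ∀ y, S (jordanForm ℵ y) = jordanForm ℵ' (S y)) : ℵ = ℵ' := by
  classical
  funext pn
  obtain ⟨e⟩ := nonempty_linearEquiv_of_restrict S (mem_kerRange_iff S hS pn)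
    (leading ℵ pn) (leading ℵ' pn) (exists_leading_eq ℵ pn) (exists_leading_eq ℵ' pn)
    (fun y hy => by
      rw [leading_eq_zero_iff hy, leading_eq_zero_iff ((mem_kerRange_iff S hS pn y).1 hy),
        exists_aeval_eq_iff S hS])
  -- The isomorphism is only F-linear, so it compares ℵ(p, n) · deg p; finiteness of deg p allows
  -- cancellation.
  have : FiniteDimensional F (AdjoinRoot pn.1.1) := pn.1.2.1.finite_adjoinRoot
  have h := cardinal_eq_of_finsupp_linearEquiv
    ((finsuppLequivDFinsupp F).trans (e.trans (finsuppLequivDFinsupp F).symm))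
  rwa [Cardinal.mk_out, Cardinal.mk_out] at h

theorem HasJordanForm.unique [PerfectField F] {V : Type x} [AddCommGroup V] [Module F V]
    {T : Module.End F V} {ℵ ℵ' : MultFn.{u, w} F} (h : HasJordanForm T ℵ)
    (h' : HasJordanForm T ℵ') : ℵ = ℵ' := by
  obtain ⟨S, hS⟩ := h
  obtain ⟨S', hS'⟩ := h'
  refine multFn_eq_of_similar (S.symm.trans S') fun y => ?_
  obtain ⟨y, rfl⟩ := S.surjective y
  simp [← hS, hS']

end Uniqueness

/-! ### Multiplying a Jordan form by a nonzero scalar -/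

section Scaling

variable {F : Type u} [Field F]

theorem Spec.coe_smul (c : Fˣ) (q : Spec F) : (c • q).1 = q.1.scaleRoots (c : F) := rfl

theorem aeval_smul_root_eq_zero (c : Fˣ) (q : Spec F) {A : Type*} [CommRing A] [Algebra F A]
    {a : A} (ha : aeval a q.1 = 0) : aeval ((c : F) • a) (c • q).1 = 0 := by
  rw [Spec.coe_smul, Algebra.smul_def]
  exact scaleRoots_aeval_eq_zero ha

/-- Since c⁻¹ x_{c⋆q} is a root of q and c x_q is a root of c ⋆ q, the two induced homomorphisms are
mutually inverse. -/
theorem exists_rootScale (c : Fˣ) (q : Spec F) :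
    ∃ θ : AdjoinRoot q.1 ≃ₐ[F] AdjoinRoot (c • q).1,
      (c : F) • θ (AdjoinRoot.root q.1) = AdjoinRoot.root (c • q).1 := by
  have h1 : aeval (((c⁻¹ : Fˣ) : F) • AdjoinRoot.root (c • q).1) q.1 = 0 := by
    have h := aeval_smul_root_eq_zero c⁻¹ (c • q) (a := AdjoinRoot.root (c • q).1)
      (by rw [AdjoinRoot.aeval_eq, AdjoinRoot.mk_self])
    rwa [inv_smul_smul] at h
  have h2 : aeval ((c : F) • AdjoinRoot.root q.1) (c • q).1 = 0 :=
    aeval_smul_root_eq_zero c q (by rw [AdjoinRoot.aeval_eq, AdjoinRoot.mk_self])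
  let f := AdjoinRoot.liftAlgHom q.1 (Algebra.ofId F (AdjoinRoot (c • q).1)) _ h1
  let g := AdjoinRoot.liftAlgHom (c • q).1 (Algebra.ofId F (AdjoinRoot q.1)) _ h2
  have hf : f (AdjoinRoot.root q.1) = ((c⁻¹ : Fˣ) : F) • AdjoinRoot.root (c • q).1 :=
    AdjoinRoot.liftAlgHom_root q.1 _ _ h1
  have hg : g (AdjoinRoot.root (c • q).1) = (c : F) • AdjoinRoot.root q.1 :=
    AdjoinRoot.liftAlgHom_root (c • q).1 _ _ h2
  refine ⟨AlgEquiv.ofAlgHom f g ?_ ?_, ?_⟩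
  · apply AdjoinRoot.algHom_ext
    rw [AlgHom.comp_apply, hg, map_smul, hf, smul_smul, Units.mul_inv, one_smul, AlgHom.id_apply]
  · apply AdjoinRoot.algHom_ext
    rw [AlgHom.comp_apply, hf, map_smul, hg, smul_smul, Units.inv_mul, one_smul, AlgHom.id_apply]
  · rw [AlgEquiv.ofAlgHom_apply, hf, smul_smul, Units.mul_inv, one_smul]

/-- The isomorphism `F_q → F_{c ⋆ q}` that sends `c x_q` to `x_{c ⋆ q}`. -/
def rootScale (c : Fˣ) (q : Spec F) : AdjoinRoot q.1 ≃ₐ[F] AdjoinRoot (c • q).1 :=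
  (exists_rootScale c q).choose

theorem rootScale_root (c : Fˣ) (q : Spec F) :
    (c : F) • rootScale c q (AdjoinRoot.root q.1) = AdjoinRoot.root (c • q).1 :=
  (exists_rootScale c q).choose_spec

/-- The similarity between `c J(q, n)` and `J(c ⋆ q, n)`. -/
def blockScale (c : Fˣ) (q : Spec F) (n : ℕ+) : BlockSpace q n ≃ₗ[F] BlockSpace (c • q) n :=
  LinearEquiv.piCongrRight fun m =>
    (rootScale c q).toLinearEquiv.trans (LinearEquiv.smulOfUnit (c ^ (m : ℕ)))

theorem blockScale_apply (c : Fˣ) (q : Spec F) (n : ℕ+) (y : BlockSpace q n) (m : Fin n) :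
    blockScale c q n y m = ((c : F) ^ (m : ℕ)) • rootScale c q (y m) := by
  rw [← Units.val_pow_eq_pow_val]
  rfl

/-- The weight c^m on coordinate m restores the ones above the diagonal: the extra c in front of
coordinate m + 1 completes c^m to c^(m+1). -/
theorem blockScale_jordanBlock (c : Fˣ) (q : Spec F) (n : ℕ+) (y : BlockSpace q n) :
    blockScale c q n ((c : F) • jordanBlock q n y) = jordanBlock (c • q) n (blockScale c q n y) := by
  funext m
  rw [jordanBlock_apply, blockScale_apply, blockScale_apply, Pi.smul_apply, jordanBlock_apply,
    map_smul, map_add, map_mul, ← rootScale_root]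
  by_cases h : (m : ℕ) + 1 < n
  · simp only [h, dite_true, blockScale_apply, Algebra.smul_def, map_pow]
    ring
  · simp only [h, dite_false, map_zero, add_zero, Algebra.smul_def, map_pow]
    ring

/-- The bijection between the blocks of `c ⋆ ℵ` and those of `ℵ`. -/
def blockIndexSMul (c : Fˣ) (ℵ : MultFn.{u, w} F) : BlockIndex (c • ℵ) ≃ BlockIndex ℵ :=
  Equiv.sigmaCongrLeft (β := fun pn => (ℵ pn).out)
    ((MulAction.toPerm c⁻¹).prodCongr (Equiv.refl ℕ+))

/-- This equation is what `blockScaleOfEq` transports along to compare blocks whose types are not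
syntactically the same. -/
theorem blockIndexSMul_symm_fst (c : Fˣ) (ℵ : MultFn.{u, w} F) (i : BlockIndex ℵ) :
    ((blockIndexSMul c ℵ).symm i).1 = (c • i.1.1, i.1.2) := by
  obtain ⟨j, rfl⟩ := (blockIndexSMul c ℵ).surjective i
  rw [Equiv.symm_apply_apply]
  exact Prod.ext (smul_inv_smul c j.1.1).symm rfl

/-- The similarity between `c J(q, n)` and `J(q', n')`, for `(q', n') = (c ⋆ q, n)`. -/
def blockScaleOfEq (c : Fˣ) (qn qn' : Spec F × ℕ+) (h : qn' = (c • qn.1, qn.2)) :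
    BlockSpace qn.1 qn.2 ≃ₗ[F] BlockSpace qn'.1 qn'.2 :=
  h ▸ blockScale c qn.1 qn.2

theorem blockScaleOfEq_jordanBlock (c : Fˣ) (qn qn' : Spec F × ℕ+) (h : qn' = (c • qn.1, qn.2))
    (y : BlockSpace qn.1 qn.2) :
    blockScaleOfEq c qn qn' h ((c : F) • jordanBlock qn.1 qn.2 y) =
      jordanBlock qn'.1 qn'.2 (blockScaleOfEq c qn qn' h y) := by
  subst h
  exact blockScale_jordanBlock c qn.1 qn.2 y

theorem exists_directSum_reindex {R ι κ : Type*} [Ring R] {M : ι → Type*} {N : κ → Type*}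
    [∀ i, AddCommGroup (M i)] [∀ i, Module R (M i)] [∀ k, AddCommGroup (N k)]
    [∀ k, Module R (N k)] (e : κ ≃ ι) (f : ∀ i, M i ≃ₗ[R] N (e.symm i)) :
    ∃ S : DirectSum ι M ≃ₗ[R] DirectSum κ N, ∀ y i, S y (e.symm i) = f i (y i) := by
  let E := DirectSum.lequivCongrLeft R (M := N) e
  refine ⟨(DFinsupp.mapRange.linearEquiv f).trans E.symm, fun y i => ?_⟩
  have h : ∀ z, E.symm z (e.symm i) = z i := by
    intro z
    have h1 : E (E.symm z) i = E.symm z (e.symm i) :=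
      DirectSum.lequivCongrLeft_apply R (M := N) e (E.symm z) i
    rw [← h1, LinearEquiv.apply_symm_apply]
  exact h _

/-- The similarity between `c J(ℵ)` and `J(c ⋆ ℵ)`. -/
theorem exists_jordanScale (c : Fˣ) (ℵ : MultFn.{u, w} F) :
    ∃ S : JordanSpace ℵ ≃ₗ[F] JordanSpace (c • ℵ), ∀ y (i : BlockIndex ℵ),
      S y ((blockIndexSMul c ℵ).symm i) =
      blockScaleOfEq c i.1 ((blockIndexSMul c ℵ).symm i).1 (blockIndexSMul_symm_fst c ℵ i)
        (y i) :=
  exists_directSum_reindex (M := fun i : BlockIndex ℵ => BlockSpace i.1.1 i.1.2)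
    (N := fun i : BlockIndex (c • ℵ) => BlockSpace i.1.1 i.1.2) (blockIndexSMul c ℵ) fun i =>
    blockScaleOfEq c i.1 ((blockIndexSMul c ℵ).symm i).1 (blockIndexSMul_symm_fst c ℵ i)

theorem jordanForm_apply (ℵ : MultFn.{u, w} F) (y : JordanSpace ℵ) (i : BlockIndex ℵ) :
    jordanForm ℵ y i = jordanBlock i.1.1 i.1.2 (y i) := rfl

theorem hasJordanForm_smul_jordanForm (c : Fˣ) (ℵ : MultFn.{u, w} F) :
    HasJordanForm ((c : F) • jordanForm ℵ) (c • ℵ) := by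
  obtain ⟨S, hS⟩ := exists_jordanScale c ℵ
  refine ⟨S, fun y => DFinsupp.ext fun j => ?_⟩
  obtain ⟨i, rfl⟩ := (blockIndexSMul c ℵ).symm.surjective j
  have h := blockScaleOfEq_jordanBlock c i.1 _ (blockIndexSMul_symm_fst c ℵ i) (y i)
  have h2 : (((c : F) • jordanForm ℵ) y) i = (c : F) • jordanBlock i.1.1 i.1.2 (y i) :=
    DFinsupp.smul_apply _ _ _
  rw [jordanForm_apply, hS, hS, h2, h]

theorem HasJordanForm.smul {V : Type x} [AddCommGroup V] [Module F V] {T : Module.End F V}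
    {ℵ : MultFn.{u, w} F} (h : HasJordanForm T ℵ) (c : Fˣ) :
    HasJordanForm ((c : F) • T) (c • ℵ) := by
  obtain ⟨S, hS⟩ := h
  obtain ⟨S', hS'⟩ := hasJordanForm_smul_jordanForm c ℵ
  refine ⟨S.trans S', fun y => ?_⟩
  rw [LinearEquiv.trans_apply, LinearEquiv.trans_apply, ← hS', LinearMap.smul_apply,
    LinearMap.smul_apply, map_smul, hS]

theorem HasJordanForm.congr {V : Type*} [AddCommGroup V] [Module F V] {T : Module.End F V}
    {W : Type*} [AddCommGroup W] [Module F W] {T' : Module.End F W}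
    {ℵ : MultFn.{u, w} F} (h : HasJordanForm T ℵ) (S : W ≃ₗ[F] V)
    (hS : ∀ y, S (T' y) = T (S y)) : HasJordanForm T' ℵ := by
  obtain ⟨S', hS'⟩ := h
  exact ⟨S.trans S', fun y => by simp [hS, hS']⟩

end Scaling

/-! ### Comparing two decompositions of one Lie algebra -/

section Decomposition

variable {F : Type u} [Field F] {L : Type w} [LieRing L] [LieAlgebra F L]

/-- The operators `T` and `c T'` are similar for some `c ≠ 0`. -/
def ProjSimilar {V W : Type*} [AddCommGroup V] [Module F V] [AddCommGroup W] [Module F W]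
    (T : Module.End F V) (T' : Module.End F W) : Prop :=
  ∃ (c : Fˣ) (S : V ≃ₗ[F] W), ∀ y, S (T y) = (c : F) • T' (S y)

/-- The linear functional with kernel `V` and value `1` at `e₀`. -/
theorem IsDecomposition.exists_coord {e₀ : L} {V : LieIdeal F L} (h : IsDecomposition e₀ V) :
    ∃ f : L →ₗ[F] F, f e₀ = 1 ∧ (∀ y, f y = 0 ↔ y ∈ V) ∧ ∀ y, y - f y • e₀ ∈ V := by
  have hsum : ∀ y : L, ∃ c : F, y - c • e₀ ∈ V := by
    intro y
    have hy : y ∈ Submodule.span F {e₀} ⊔ V.toSubmodule := by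
      rw [h.isCompl.sup_eq_top]; trivial
    obtain ⟨a, ha, b, hb, rfl⟩ := Submodule.mem_sup.1 hy
    obtain ⟨c, rfl⟩ := Submodule.mem_span_singleton.1 ha
    exact ⟨c, by simpa using hb⟩
  have huniq : ∀ c : F, c • e₀ ∈ V → c = 0 := by
    intro c hc
    have h1 := Submodule.disjoint_def.1 h.isCompl.disjoint _
      (Submodule.mem_span_singleton.2 ⟨c, rfl⟩) hc
    exact (smul_eq_zero.1 h1).resolve_right h.ne_zero
  have huniq' : ∀ (y : L) (c d : F), y - c • e₀ ∈ V → y - d • e₀ ∈ V → c = d := by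
    intro y c d hc hd
    refine sub_eq_zero.1 (huniq _ ?_)
    have h1 := sub_mem hd hc
    rwa [sub_sub_sub_cancel_left, ← sub_smul] at h1
  choose f hf using hsum
  refine ⟨⟨⟨f, fun y z => ?_⟩, fun c y => ?_⟩, ?_, fun y => ⟨fun hy => ?_, fun hy => ?_⟩, hf⟩
  · refine huniq' _ _ _ (hf _) ?_
    rw [add_smul, add_sub_add_comm]
    exact add_mem (hf y) (hf z)
  · refine huniq' _ _ _ (hf _) ?_
    rw [RingHom.id_apply, smul_eq_mul, mul_smul, ← smul_sub]
    exact SMulMemClass.smul_mem c (hf y)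
  · exact huniq' _ _ _ (hf _) (by rw [one_smul, sub_self]; exact zero_mem V)
  · have h1 := hf y
    rwa [show f y = 0 from hy, zero_smul, sub_zero] at h1
  · exact huniq' _ _ _ (hf _) (by rwa [zero_smul, sub_zero])

theorem IsDecomposition.lie_eq_zero {e₀ : L} {V : LieIdeal F L} (h : IsDecomposition e₀ V)
    {y z : L} (hy : y ∈ V) (hz : z ∈ V) : ⁅y, z⁆ = 0 :=
  congrArg Subtype.val (h.abelian.trivial ⟨y, hy⟩ ⟨z, hz⟩)

theorem adOn_apply (e₀ : L) (V : LieIdeal F L) (y : V) : (adOn e₀ V y : L) = ⁅e₀, (y : L)⁆ := rfl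

/-- A vector of V' outside V would force e₀, and then e₀', into V'. -/
theorem IsDecomposition.eq_of_le {e₀ e₀' : L} {V V' : LieIdeal F L} (h : IsDecomposition e₀ V)
    (h' : IsDecomposition e₀' V') (hle : V ≤ V') : V = V' := by
  obtain ⟨f, -, hf, hf'⟩ := h.exists_coord
  obtain ⟨g, hg1, hg, -⟩ := h'.exists_coord
  refine le_antisymm hle fun y hy => ?_
  by_contra hyV
  have hfy : f y ≠ 0 := fun h0 => hyV ((hf y).1 h0)
  have h0 : f y • g e₀ = 0 := by
    have h1 := (hg _).2 (hle (hf' y))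
    rw [map_sub, (hg y).2 hy, map_smul, zero_sub, neg_eq_zero] at h1
    exact h1
  have he : g e₀ = 0 := (smul_eq_zero.1 h0).resolve_left hfy
  have h1 := (hg _).2 (hle (hf' e₀'))
  rw [map_sub, map_smul, he, hg1, smul_zero, sub_zero] at h1
  exact one_ne_zero h1

/-- The operators of two decompositions of the same Lie algebra are similar up to a factor. -/
theorem IsDecomposition.projSimilar {e₀ e₀' : L} {V V' : LieIdeal F L}
    (h : IsDecomposition e₀ V) (h' : IsDecomposition e₀' V') :
    ProjSimilar (adOn e₀ V) (adOn e₀' V') := by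
  by_cases hVV : V = V'
  · subst hVV
    obtain ⟨f, hf1, hf, hf'⟩ := h'.exists_coord
    have hc : f e₀ ≠ 0 := by
      intro h0
      have h1 := (Submodule.disjoint_def.1 h.isCompl.disjoint _
        (Submodule.mem_span_singleton_self e₀) ((hf _).1 h0))
      exact h.ne_zero h1
    -- Modulo the ideal e₀ is `f e₀ • e₀'`, and the ideal acts on itself by zero.
    refine ⟨Units.mk0 _ hc, LinearEquiv.refl F V, fun y => Subtype.ext ?_⟩
    have h1 := h.lie_eq_zero (hf' e₀) y.2
    rw [sub_lie, smul_lie, sub_eq_zero] at h1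
    exact h1
  · obtain ⟨g, hg1, hg, hg'⟩ := h.exists_coord
    obtain ⟨f, hf1, hf, hf'⟩ := h'.exists_coord
    have hv : ∃ v ∈ V, f v = 1 := by
      by_contra! hcon
      refine hVV (h.eq_of_le h' fun y hy => (hf y).1 ?_)
      by_contra hy0
      refine hcon ((f y)⁻¹ • y) (SMulMemClass.smul_mem _ hy) ?_
      rw [map_smul, smul_eq_mul, inv_mul_cancel₀ hy0]
    have hv' : ∃ v ∈ V', g v = 1 := by
      by_contra! hcon
      refine hVV (h'.eq_of_le h fun y hy => (hg y).1 ?_).symm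
      by_contra hy0
      refine hcon ((g y)⁻¹ • y) (SMulMemClass.smul_mem _ hy) ?_
      rw [map_smul, smul_eq_mul, inv_mul_cancel₀ hy0]
    obtain ⟨v, hvV, hfv⟩ := hv
    obtain ⟨v', hvV', hgv⟩ := hv'
    have hgv0 := (hg v).2 hvV
    have hfv0 := (hf v').2 hvV'
    -- Modulo V, e₀ agrees with v'; modulo V', y agrees with `f y • v`. So e₀ acts on V with rank at
    -- most one.
    have hbr : ∀ y ∈ V, ⁅e₀, y⁆ = f y • ⁅v', v⁆ := by
      intro y hy
      have h1 : ⁅e₀ - v', y⁆ = 0 := h.lie_eq_zero ((hg _).1 (by rw [map_sub, hg1, hgv, sub_self])) hy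
      have h2 : ⁅v', y - f y • v⁆ = 0 := h'.lie_eq_zero hvV'
        ((hf _).1 (by rw [map_sub, map_smul, hfv, smul_eq_mul, mul_one, sub_self]))
      rw [sub_lie, sub_eq_zero] at h1
      rw [lie_sub, lie_smul, sub_eq_zero] at h2
      rw [h1, h2]
    have hbr' : ∀ y ∈ V', ⁅e₀', y⁆ = g y • ⁅v, v'⁆ := by
      intro y hy
      have h1 : ⁅e₀' - v, y⁆ = 0 := h'.lie_eq_zero ((hf _).1 (by rw [map_sub, hf1, hfv, sub_self])) hy
      have h2 : ⁅v, y - g y • v'⁆ = 0 := h.lie_eq_zero hvV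
        ((hg _).1 (by rw [map_sub, map_smul, hgv, smul_eq_mul, mul_one, sub_self]))
      rw [sub_lie, sub_eq_zero] at h1
      rw [lie_sub, lie_smul, sub_eq_zero] at h2
      rw [h1, h2]
    have hmem : ∀ y : V, (y : L) - f y • (v + v') ∈ V' := fun y =>
      (hf _).1 (by rw [map_sub, map_smul, map_add, hfv, hfv0, add_zero, smul_eq_mul, mul_one,
        sub_self])
    have hmem' : ∀ y : V', (y : L) - g y • (v + v') ∈ V := fun y =>
      (hg _).1 (by rw [map_sub, map_smul, map_add, hgv, hgv0, zero_add, smul_eq_mul, mul_one,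
        sub_self])
    have hgS : ∀ y : V, g ((y : L) - f y • (v + v')) = - f y := fun y => by
      rw [map_sub, map_smul, map_add, hgv, hgv0, (hg _).2 y.2]; simp
    have hfS : ∀ y : V', f ((y : L) - g y • (v + v')) = - g y := fun y => by
      rw [map_sub, map_smul, map_add, hfv, hfv0, (hf _).2 y.2]; simp
    -- S fixes V ∩ V' and sends v to -v'. The sign turns ⁅v, v'⁆ into ⁅v', v⁆, so the operators
    -- match with factor 1.
    let S : V ≃ₗ[F] V' :=
      { toFun := fun y => ⟨(y : L) - f y • (v + v'), hmem y⟩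
        map_add' := fun y z => Subtype.ext (by
          change ((y : L) + z) - f ((y : L) + z) • (v + v') =
            ((y : L) - f y • (v + v')) + ((z : L) - f z • (v + v'))
          rw [map_add, add_smul]; abel)
        map_smul' := fun c y => Subtype.ext (by
          change c • (y : L) - f (c • (y : L)) • (v + v') = c • ((y : L) - f y • (v + v'))
          rw [map_smul, smul_eq_mul, mul_smul, smul_sub])
        invFun := fun y => ⟨(y : L) - g y • (v + v'), hmem' y⟩
        left_inv := fun y => Subtype.ext (by
          change ((y : L) - f y • (v + v')) - g ((y : L) - f y • (v + v')) • (v + v') = y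
          rw [hgS, neg_smul]; abel)
        right_inv := fun y => Subtype.ext (by
          change ((y : L) - g y • (v + v')) - f ((y : L) - g y • (v + v')) • (v + v') = y
          rw [hfS, neg_smul]; abel) }
    refine ⟨1, S, fun y => Subtype.ext ?_⟩
    rw [Units.val_one, one_smul, adOn_apply]
    change ⁅e₀, (y : L)⁆ - f ⁅e₀, (y : L)⁆ • (v + v') = ⁅e₀', (y : L) - f y • (v + v')⁆
    have h0 : f ⁅v', v⁆ = 0 := (hf _).2 (lie_mem_left F L V' _ _ hvV')
    rw [hbr' _ (hmem y), hgS, hbr _ y.2, map_smul, h0, smul_zero, zero_smul, sub_zero, neg_smul,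
      ← smul_neg, lie_skew]

end Decomposition

/-! ### Isomorphism classes and orbits -/

section Classification

variable {F : Type u} [Field F]

section Projective

variable {V W : Type*} [AddCommGroup V] [Module F V] [AddCommGroup W] [Module F W]
  {T : Module.End F V} {T' : Module.End F W}

theorem ProjSimilar.exists_hasJordanForm (h : ProjSimilar T T') {ℵ : MultFn.{u, w} F}
    (hℵ : HasJordanForm T' ℵ) : ∃ c : Fˣ, HasJordanForm T (c • ℵ) := by
  obtain ⟨c, S, hS⟩ := h
  exact ⟨c, (hℵ.smul c).congr S hS⟩

theorem ProjSimilar.of_hasJordanForm {c : Fˣ} {ℵ : MultFn.{u, w} F}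
    (h : HasJordanForm T (c • ℵ)) (h' : HasJordanForm T' ℵ) : ProjSimilar T T' := by
  obtain ⟨S, hS⟩ := h
  obtain ⟨S', hS'⟩ := h'.smul c
  refine ⟨c, S.trans S'.symm, fun y => S'.injective ?_⟩
  change S' (S'.symm (S (T y))) = S' (((c : F) • T') (S'.symm (S y)))
  rw [hS', LinearEquiv.apply_symm_apply, LinearEquiv.apply_symm_apply, hS]

/-- Operators that are similar up to a factor define isomorphic Lie algebras. -/
def Semidirect.congr (c : Fˣ) (S : V ≃ₗ[F] W) (hS : ∀ y, S (T y) = (c : F) • T' (S y)) :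
    Semidirect T ≃ₗ⁅F⁆ Semidirect T' where
  toFun y := ⟨c * y.coord, S y.vec⟩
  map_add' y z := by ext <;> simp [mul_add]
  map_smul' a y := by
    ext
    · simp [mul_left_comm]
    · simp
  map_lie' {y z} := by
    ext
    · simp
    · simp [hS, smul_smul, mul_comm]
  invFun y := ⟨(c⁻¹ : Fˣ) * y.coord, S.symm y.vec⟩
  left_inv y := by ext <;> simp
  right_inv y := by ext <;> simp

end Projective

section Decomposition

variable {L : Type w} [LieRing L] [LieAlgebra F L] {e₀ : L} {V : LieIdeal F L}

theorem IsDecomposition.nonempty_lieEquiv (h : IsDecomposition e₀ V) :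
    Nonempty (L ≃ₗ⁅F⁆ Semidirect (adOn e₀ V)) := by
  obtain ⟨f, hf1, hf, hf'⟩ := h.exists_coord
  have hfV : ∀ (a : F) (y : V), f (a • e₀ + y) = a := fun a y => by
    rw [map_add, (hf _).2 y.2, map_smul, hf1, smul_eq_mul, mul_one, add_zero]
  have hfl : ∀ y z : L, f ⁅y, z⁆ = 0 := fun y z => by
    have hy : y = f y • e₀ + (y - f y • e₀) := by abel
    have hz : z = f z • e₀ + (z - f z • e₀) := by abel
    rw [hy, hz, add_lie, lie_add, smul_lie, lie_smul, lie_self, smul_zero, smul_zero, zero_add]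
    exact (hf _).2 (add_mem (lie_mem_right F L V _ _ (hf' z)) (lie_mem_left F L V _ _ (hf' y)))
  refine ⟨LieEquiv.symm
    { toFun := fun y => y.coord • e₀ + (y.vec : L)
      map_add' := fun y z => ?_
      map_smul' := fun c y => ?_
      map_lie' := fun {y z} => ?_
      invFun := fun y => ⟨f y, ⟨y - f y • e₀, hf' y⟩⟩
      left_inv := fun y => ?_
      right_inv := fun y => ?_ }⟩
  · rw [Semidirect.add_coord, Semidirect.add_vec, add_smul, Submodule.coe_add]
    abel
  · rw [Semidirect.smul_coord, Semidirect.smul_vec, mul_smul, RingHom.id_apply, smul_add]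
    rfl
  · have h0 := h.lie_eq_zero y.vec.2 z.vec.2
    change (0 : F) • e₀ + (y.coord • ⁅e₀, (z.vec : L)⁆ - z.coord • ⁅e₀, (y.vec : L)⁆) = _
    rw [add_lie, lie_add, lie_add, h0, smul_lie, lie_smul, lie_self, smul_lie, lie_smul,
      ← lie_skew (y.vec : L) e₀]
    simp only [smul_zero, zero_smul, smul_neg]
    abel
  · have h1 := hfV y.coord y.vec
    refine Semidirect.ext h1 (Subtype.ext ?_)
    change y.coord • e₀ + (y.vec : L) - f (y.coord • e₀ + (y.vec : L)) • e₀ = y.vec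
    rw [h1]
    abel
  · change f y • e₀ + (y - f y • e₀) = y
    abel

theorem IsDecomposition.adOn_ne_zero (h : IsDecomposition e₀ V) (hL : ¬ IsLieAbelian L) :
    adOn e₀ V ≠ 0 := by
  intro h0
  obtain ⟨f, hf1, hf, hf'⟩ := h.exists_coord
  have hz : ∀ y ∈ V, ⁅e₀, y⁆ = 0 := fun y hy =>
    congrArg Subtype.val (LinearMap.congr_fun h0 ⟨y, hy⟩)
  refine hL ⟨fun y z => ?_⟩
  have hy : y = f y • e₀ + (y - f y • e₀) := by abel
  have hz' : z = f z • e₀ + (z - f z • e₀) := by abel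
  rw [hy, hz', add_lie, lie_add, lie_add, h.lie_eq_zero (hf' y) (hf' z), smul_lie, lie_smul,
    lie_self, smul_lie, hz _ (hf' z), lie_smul, ← lie_skew, hz _ (hf' y)]
  simp

/-- A decomposition can be pulled back along an isomorphism. -/
theorem IsDecomposition.exists_comap (h : IsDecomposition e₀ V) {M : Type*} [LieRing M]
    [LieAlgebra F M] (e : M ≃ₗ⁅F⁆ L) :
    ∃ (e₁ : M) (V₁ : LieIdeal F M), IsDecomposition e₁ V₁ ∧
      ∃ S : V₁ ≃ₗ[F] V, ∀ y, S (adOn e₁ V₁ y) = adOn e₀ V (S y) := by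
  have hmem : ∀ y, y ∈ V.comap e.toLieHom ↔ e y ∈ V := fun y => LieIdeal.mem_comap
  obtain ⟨f, hf1, hf, hf'⟩ := h.exists_coord
  refine ⟨e.symm e₀, V.comap e.toLieHom, ⟨?_, ⟨fun y z => ?_⟩, ?_⟩, ?_⟩
  · intro h0
    refine h.ne_zero ?_
    rw [← e.apply_symm_apply e₀, h0]
    exact map_zero e.toLieHom
  · refine Subtype.ext (e.injective ?_)
    change e ⁅(y : M), (z : M)⁆ = e 0
    rw [LieEquiv.map_lie, h.lie_eq_zero ((hmem _).1 y.2) ((hmem _).1 z.2)]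
    exact (map_zero e.toLieHom).symm
  · constructor
    · rw [Submodule.disjoint_def]
      intro y hy hyV
      obtain ⟨c, rfl⟩ := Submodule.mem_span_singleton.1 hy
      have h1 := (hf _).2 ((hmem _).1 hyV)
      have h2 : e (c • e.symm e₀) = c • e₀ := by
        have := map_smul e.toLieHom c (e.symm e₀)
        exact this.trans (congrArg _ (e.apply_symm_apply e₀))
      rw [h2, map_smul, hf1, smul_eq_mul, mul_one] at h1
      rw [h1, zero_smul]
    · rw [codisjoint_iff, Submodule.eq_top_iff']
      intro y
      rw [Submodule.mem_sup]
      refine ⟨f (e y) • e.symm e₀, Submodule.mem_span_singleton.2 ⟨_, rfl⟩,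
        y - f (e y) • e.symm e₀, (hmem _).2 ?_, by abel⟩
      have h2 : e (y - f (e y) • e.symm e₀) = e y - f (e y) • e₀ := by
        have := map_sub e.toLieHom y (f (e y) • e.symm e₀)
        rw [map_smul] at this
        exact this.trans (congrArg (fun t => e y - f (e y) • t) (e.apply_symm_apply e₀))
      rw [h2]
      exact hf' _
  · refine ⟨e.toLinearEquiv.ofSubmodules _ _ ?_, fun y => Subtype.ext ?_⟩
    · ext y
      constructor
      · rintro ⟨z, hz, rfl⟩
        exact (hmem z).1 hz
      · intro hy
        exact ⟨e.symm y, (hmem _).2 (by rwa [e.apply_symm_apply]), e.apply_symm_apply y⟩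
    · change e ⁅e.symm e₀, (y : M)⁆ = ⁅e₀, e (y : M)⁆
      rw [LieEquiv.map_lie, e.apply_symm_apply]

theorem IsDecomposition.projSimilar_of_lieEquiv (h : IsDecomposition e₀ V) {M : Type*} [LieRing M]
    [LieAlgebra F M] {e₁ : M} {V₁ : LieIdeal F M} (h₁ : IsDecomposition e₁ V₁)
    (e : M ≃ₗ⁅F⁆ L) : ProjSimilar (adOn e₁ V₁) (adOn e₀ V) := by
  obtain ⟨e₂, V₂, h₂, S₂, hS₂⟩ := h.exists_comap e
  obtain ⟨c, S, hS⟩ := h₁.projSimilar h₂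
  exact ⟨c, S.trans S₂, fun y => by simp [hS, hS₂]⟩

theorem ProjSimilar.nonempty_lieEquiv (h : IsDecomposition e₀ V) {M : Type*} [LieRing M]
    [LieAlgebra F M] {e₁ : M} {V₁ : LieIdeal F M} (h₁ : IsDecomposition e₁ V₁)
    (hs : ProjSimilar (adOn e₁ V₁) (adOn e₀ V)) : Nonempty (M ≃ₗ⁅F⁆ L) := by
  obtain ⟨f⟩ := h.nonempty_lieEquiv
  obtain ⟨g⟩ := h₁.nonempty_lieEquiv
  obtain ⟨c, S, hS⟩ := hs
  exact ⟨(g.trans (Semidirect.congr c S hS)).trans f.symm⟩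

end Decomposition

theorem jordanBlock_eq_zero {pn : Spec F × ℕ+} (h : pn = (Spec.X, 1)) :
    jordanBlock pn.1 pn.2 = 0 := by
  subst h
  have h0 : AdjoinRoot.root (Spec.X : Spec F).1 = 0 := AdjoinRoot.mk_self
  refine LinearMap.ext fun v => funext fun m => ?_
  have hm : ¬ (m : ℕ) + 1 < ((1 : ℕ+) : ℕ) := by simp
  rw [jordanBlock_apply, dif_neg hm, h0, zero_mul, add_zero]
  rfl

theorem HasJordanForm.nontriv {V : Type x} [AddCommGroup V] [Module F V] {T : Module.End F V}
    {ℵ : MultFn.{u, w} F} (h : HasJordanForm T ℵ) (hT : T ≠ 0) : ℵ.Nontriv := by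
  by_contra hn
  refine hT (LinearMap.ext fun y => ?_)
  obtain ⟨S, hS⟩ := h
  refine S.injective ?_
  rw [hS, LinearMap.zero_apply, map_zero]
  refine DFinsupp.ext fun i => ?_
  have hi : i.1 = (Spec.X, 1) := by
    by_contra hne
    refine hn ⟨i.1, ?_, hne⟩
    rw [← Cardinal.mk_out (ℵ i.1), Cardinal.mk_ne_zero_iff]
    exact ⟨i.2⟩
  rw [jordanForm_apply, jordanBlock_eq_zero hi]
  rfl

/-- `ℵ` is the multiplicity function of some decomposition of `L`. -/
def IsMultFnOf (L : JordanableAA.{u, w} F) (ℵ : MultFn.{u, w} F) : Prop :=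
  ∃ (e₀ : L.carrier) (V : LieIdeal F L.carrier), IsDecomposition e₀ V ∧
    HasJordanForm (adOn e₀ V) ℵ

theorem exists_isMultFnOf (L : JordanableAA.{u, w} F) : ∃ ℵ, IsMultFnOf L ℵ := by
  obtain ⟨e₀, V, h, ℵ, hℵ⟩ := L.jordanable
  exact ⟨ℵ, e₀, V, h, hℵ⟩

theorem IsMultFnOf.nontriv {L : JordanableAA.{u, w} F} {ℵ : MultFn.{u, w} F}
    (h : IsMultFnOf L ℵ) : ℵ.Nontriv := by
  obtain ⟨e₀, V, h, hℵ⟩ := h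
  exact hℵ.nontriv (h.adOn_ne_zero L.almostAbelian.1)

/-- An isomorphism makes the two operators similar up to a factor, and uniqueness of the Jordan form
turns the factor into the action on ℵ. Conversely, operators similar up to a factor give isomorphic
semidirect products. -/
theorem IsMultFnOf.nonempty_lieEquiv_iff [PerfectField F] {L M : JordanableAA.{u, w} F}
    {ℵ ℵ' : MultFn.{u, w} F} (h : IsMultFnOf L ℵ) (h' : IsMultFnOf M ℵ') :
    Nonempty (L.carrier ≃ₗ⁅F⁆ M.carrier) ↔ MulAction.orbit Fˣ ℵ = MulAction.orbit Fˣ ℵ' := by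
  obtain ⟨e₀, V, h, hℵ⟩ := h
  obtain ⟨e₀', V', h', hℵ'⟩ := h'
  rw [MulAction.orbit_eq_iff]
  constructor
  · rintro ⟨e⟩
    obtain ⟨c, hc⟩ := (h'.projSimilar_of_lieEquiv h e).exists_hasJordanForm hℵ'
    exact ⟨c, hc.unique hℵ⟩
  · rintro ⟨c, rfl⟩
    exact ProjSimilar.nonempty_lieEquiv h' h (ProjSimilar.of_hasJordanForm hℵ hℵ')

/-- The projective multiplicity function of a Jordanable almost Abelian Lie algebra. -/
def projMultOf (L : JordanableAA.{u, w} F) : ProjMult.{u, w} F :=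
  ProjMult.mk (exists_isMultFnOf L).choose (exists_isMultFnOf L).choose_spec.nontriv

theorem projMultOf_eq_iff [PerfectField F] (L M : JordanableAA.{u, w} F) :
    projMultOf L = projMultOf M ↔ Nonempty (L.carrier ≃ₗ⁅F⁆ M.carrier) :=
  Subtype.ext_iff.trans ((exists_isMultFnOf L).choose_spec.nonempty_lieEquiv_iff
    (exists_isMultFnOf M).choose_spec).symm

/-- The arbitrary choice in `projMultOf` is harmless: the identity isomorphism puts all multiplicity
functions of L in one orbit. -/
theorem IsMultFnOf.projMultOf_eq [PerfectField F] {L : JordanableAA.{u, w} F}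
    {ℵ : MultFn.{u, w} F} (h : IsMultFnOf L ℵ) : projMultOf L = ProjMult.mk ℵ h.nontriv :=
  Subtype.ext (((exists_isMultFnOf L).choose_spec.nonempty_lieEquiv_iff h).1 ⟨LieEquiv.refl⟩)

theorem isMultFnOf_aA (ℵ : MultFn.{u, max u v} F) (h : ℵ.Nontriv) :
    IsMultFnOf (aA.{u, v} ℵ h) ℵ :=
  ⟨Semidirect.e0 _, Semidirect.ideal _, Semidirect.isDecomposition,
    Semidirect.idealEquiv _, Semidirect.idealEquiv_ad⟩

/-- The map from isomorphism classes to projective multiplicity functions. -/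
def classMap (F : Type u) [Field F] [PerfectField F] : IsoClass.{u, w} F → ProjMult.{u, w} F :=
  Quotient.lift projMultOf fun L M h => (projMultOf_eq_iff L M).2 h

theorem classMap_aA [PerfectField F] (ℵ : MultFn.{u, max u v} F) (h : ℵ.Nontriv) :
    classMap F (IsoClass.mk (aA.{u, v} ℵ h)) = ProjMult.mk ℵ h :=
  (isMultFnOf_aA ℵ h).projMultOf_eq

/-- The universe `max u v` leaves room for `aA ℵ`, whose carrier is built from F and the fields F_p;
these algebras give surjectivity. -/
theorem classMap_bijective (F : Type u) [Field F] [PerfectField F] :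
    Function.Bijective (classMap.{u, max u v} F) := by
  constructor
  · intro a b
    induction a using Quotient.inductionOn with | h L => ?_
    induction b using Quotient.inductionOn with | h M => ?_
    exact fun h => Quotient.sound ((projMultOf_eq_iff L M).1 h)
  · rintro ⟨o, ℵ, h, rfl⟩
    exact ⟨_, classMap_aA.{u, v} ℵ h⟩

/-- Jordanability is given for one decomposition only; it passes to every other because the
operators are similar up to a factor. -/
theorem JordanableAA.exists_hasJordanForm (L : JordanableAA.{u, w} F) {e₀ : L.carrier}
    {V : LieIdeal F L.carrier} (h : IsDecomposition e₀ V) :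
    ∃ ℵ : MultFn.{u, w} F, HasJordanForm (adOn e₀ V) ℵ := by
  obtain ⟨ℵ, e₁, V₁, h₁, hℵ⟩ := exists_isMultFnOf L
  obtain ⟨c, hc⟩ := (h.projSimilar h₁).exists_hasJordanForm hℵ
  exact ⟨_, hc⟩

end Classification

end AlmostAbelian

end

theorem mainTheorem5 {F : Type u} [Field F] [PerfectField F] :
    ∃ Φ : AlmostAbelian.IsoClass.{u, max u v} F ≃ AlmostAbelian.ProjMult.{u, max u v} F,
      (∀ (L : AlmostAbelian.JordanableAA.{u, max u v} F) (e₀ : L.carrier)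
        (V : LieIdeal F L.carrier), AlmostAbelian.IsDecomposition e₀ V →
          ∃ (ℵ : AlmostAbelian.MultFn.{u, max u v} F) (h : ℵ.Nontriv),
            (∀ ℵ' : AlmostAbelian.MultFn.{u, max u v} F,
              AlmostAbelian.HasJordanForm (AlmostAbelian.adOn e₀ V) ℵ' ↔ ℵ' = ℵ) ∧
            Φ (AlmostAbelian.IsoClass.mk L) = AlmostAbelian.ProjMult.mk ℵ h) ∧
      (∀ (ℵ : AlmostAbelian.MultFn.{u, max u v} F) (h : ℵ.Nontriv),
        Φ.symm (AlmostAbelian.ProjMult.mk ℵ h) =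
          AlmostAbelian.IsoClass.mk (AlmostAbelian.aA.{u, v} ℵ h)) := by
  refine ⟨Equiv.ofBijective _ (AlmostAbelian.classMap_bijective.{u, v} F), ?_, ?_⟩
  · intro L e₀ V h
    obtain ⟨ℵ, hℵ⟩ := L.exists_hasJordanForm h
    have hm : AlmostAbelian.IsMultFnOf L ℵ := ⟨e₀, V, h, hℵ⟩
    refine ⟨ℵ, hm.nontriv, fun ℵ' => ⟨fun h' => h'.unique hℵ, ?_⟩, hm.projMultOf_eq⟩
    rintro rfl
    exact hℵ
  · intro ℵ h
    rw [Equiv.symm_apply_eq]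
    exact (AlmostAbelian.classMap_aA.{u, v} ℵ h).symm
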